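/- **The algorithm.** Let $M\ge 6$ be an integer and consider an insertion-only stream $e_1,e_2,\dots$ of distinct undirected edges without self-loops, fixed independently of the algorithm's random bits. Let $G^{(t)}$ be the graph with edge set $E^{(t)}=\{e_1,\dots,e_t\}$. TRIÈST-BASE keeps a sample $\mathcal S$ of edges and an integer counter $\tau$, initially $\mathcal S=\emptyset$, $\tau=0$. At time $t$, on receiving $e_t$: - if $t\le M$, it inserts $e_t$ into $\mathcal S$; - if $t>M$, it flips an independent coin with heads probability $M/t$; on heads it removes an edge of $\mathcal S$ chosen uniformly at random and then inserts $e_t$ into $\mathcal S$; on tails it changes nothing. After each insertion (resp. removal) of an edge $(u,v)$ into (resp. from) $\mathcal S$, it increases (resp. decreases) $\tau$ by the number of common neighbors of $u$ and $v$ in the graph with edge set $\mathcal S$. Let $\tau^{(t)}$ be the value of $\tau$ at the end of step $t$, and let $$\xi^{(t)}=\begin{cases}1,&t\le M,\\ \binom tM\Big/\binom{t-3}{M-3}=\dfrac{t(t-1)(t-2)}{M(M-1)(M-2)},&t>M.\end{cases}$$ The estimate returned at time $t$ is $\xi^{(t)}\tau^{(t)}$. **Theorem.** Let $t\ge 0$,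 let $\Delta^{(t)}$ be the set of triangles of $G^{(t)}$, and let $h^{(t)}$ be the maximum number of triangles of $G^{(t)}$ sharing a single edge. Assume $|\Delta^{(t)}|>0$. For any $\varepsilon,\delta\in(0,1)$, let $$\Phi=\sqrt[3]{8\varepsilon^{-2}\,\frac{3h^{(t)}+1}{|\Delta^{(t)}|}\,\ln\left(\frac{(3h^{(t)}+1)e}{\delta}\right)}.$$ If $$M\ge\max\left\{t\Phi\left(1+\tfrac12\ln^{2/3}(t\Phi)\right),\;12\varepsilon^{-1}+e^2,\;25\right\},$$ then $$\Pr\left(\left|\xi^{(t)}\tau^{(t)}-|\Delta^{(t)}|\right|<\varepsilon|\Delta^{(t)}|\right)>1-\delta .$$ -/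

import Mathlib

open scoped NNReal ENNReal

noncomputable section

namespace Triest

/-! ### Insertion-only edge streams, triangles -/

section Graph

variable {V : Type*} [DecidableEq V]

/-- The edge set `E^(t)` of the graph observed up to time `t`, where `e t` is the edge that the
insertion-only stream delivers at time `t` (times start at `1`; `e 0` is never read). -/
def edges (e : ℕ → Sym2 V) : ℕ → Finset (Sym2 V)
  | 0 => ∅
  | t + 1 => insert (e (t + 1)) (edges e t)

/-- The stream is legal up to time `t`: each element joins two distinct vertices, and each
insertion has an effect (the inserted edge is not already in the graph). -/
def ValidUpTo (e : ℕ → Sym2 V) (t : ℕ) : Prop :=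
  ∀ s < t, ¬ (e (s + 1)).IsDiag ∧ e (s + 1) ∉ edges e s

open Classical in
/-- The set of all triangles of the graph with edge set `E`: the sets of three edges
`{uv, vw, wu} ⊆ E` with `u`, `v`, `w` distinct. -/
def triangles (E : Finset (Sym2 V)) : Finset (Finset (Sym2 V)) :=
  E.powerset.filter fun T =>
    ∃ u v w : V, u ≠ v ∧ v ≠ w ∧ w ≠ u ∧ T = {s(u, v), s(v, w), s(w, u)}

/-- The maximum number of triangles sharing a single edge. -/
def maxTrianglesPerEdge (E : Finset (Sym2 V)) : ℕ :=
  E.sup fun a => ((triangles E).filter fun T => a ∈ T).card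

end Graph

/-! ### The algorithm -/

/-- The memory of the algorithm: the edge sample `S` and the global counter `τ`. -/
structure State (V : Type*) where
  sample : Finset (Sym2 V)
  counter : ℤ

section Algorithm

variable {V : Type*} [DecidableEq V]

/-- The shared neighborhood, in the graph with edge set `S`, of the two ends of `a`. -/
def sharedNeighbors (S : Finset (Sym2 V)) (a : Sym2 V) : Set V :=
  {c | ∀ u ∈ a, s(u, c) ∈ S}

/-- `UpdateCounters`: add `sign` (`1` or `-1`) to the global counter once for each shared
neighbor of the two ends of `a` in the current sample. -/
def updateCounters (sign : ℤ) (a : Sym2 V) (st : State V) : State V where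
  sample := st.sample
  counter := st.counter + sign * ((sharedNeighbors st.sample a).ncard : ℤ)

/-- Put `a` into the sample, then call `UpdateCounters(+, a)`. -/
def insertEdge (a : Sym2 V) (st : State V) : State V :=
  updateCounters 1 a { sample := insert a st.sample, counter := st.counter }

/-- Delete `a` from the sample, then call `UpdateCounters(-, a)`. -/
def removeEdge (a : Sym2 V) (st : State V) : State V :=
  updateCounters (-1) a { sample := st.sample.erase a, counter := st.counter }

/-- `FlipBiasedCoin(M / t)`: `true` (heads) with probability `M / t`, for `M < t`. -/
def flipBiasedCoin (M t : ℕ) (h : M < t) : PMF Bool :=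
  PMF.ofFintype (fun b => (if b then (M : ℝ≥0) / t else 1 - (M : ℝ≥0) / t : ℝ≥0)) (by
    have ht : (0 : ℝ≥0) < t := by exact_mod_cast (Nat.zero_le M).trans_lt h
    have hle : (M : ℝ≥0) / t ≤ 1 := by
      rw [div_le_one ht]
      exact_mod_cast h.le
    rw [Fintype.sum_bool, ← ENNReal.coe_add]
    simp only [if_true, Bool.false_eq_true, if_false]
    rw [add_tsub_cancel_of_le hle, ENNReal.coe_one])

/-- `SampleEdge` at time `t`: the answer tells whether the new edge has to be stored, and the
state is the one after the possible removal of a uniformly random sampled edge. (For `M ≥ 1` and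
`t > M` the sample holds `M` edges, so the branch with an empty sample is never reached.) -/
def sampleEdge (M t : ℕ) (st : State V) : PMF (State V × Bool) :=
  if h : t ≤ M then PMF.pure (st, true)
  else (flipBiasedCoin M t (not_le.mp h)).bind fun heads =>
    if heads then
      if hS : st.sample.Nonempty then
        (PMF.uniformOfFinset st.sample hS).bind fun a => PMF.pure (removeEdge a st, true)
      else PMF.pure (st, true)
    else PMF.pure (st, false)

/-- The processing of the stream edge `a` that arrives at time `t`. -/
def processEdge (M t : ℕ) (a : Sym2 V) (st : State V) : PMF (State V) :=
  (sampleEdge M t st).map fun r => if r.2 then insertEdge a r.1 else r.1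

/-- The law of the state of TRIEST-BASE with sample size `M` at the end of time step `t`, on the
insertion-only stream `e`. -/
def run (M : ℕ) (e : ℕ → Sym2 V) : ℕ → PMF (State V)
  | 0 => PMF.pure { sample := ∅, counter := 0 }
  | t + 1 => (run M e t).bind fun st => processEdge M (t + 1) (e (t + 1)) st

end Algorithm

/-- `ξ_{a,b}` for sample size `M` (used with `a ≤ min M b`). -/
def xi (M a b : ℕ) : ℝ :=
  if b ≤ M then 1 else (b.choose M : ℝ) / ((b - a).choose (M - a) : ℝ)

/-- The estimate `ξ^(t) τ^(t)` that is returned at the end of time step `t`. -/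
def estimate {V : Type*} (M t : ℕ) (st : State V) : ℝ :=
  xi M 3 t * (st.counter : ℝ)

/-- The quantity `Φ`, for `h` triangles at most on an edge and `D` triangles in all. -/
def Phi (ε δ : ℝ) (h D : ℕ) : ℝ :=
  (8 * ε⁻¹ ^ 2 * ((3 * (h : ℝ) + 1) / (D : ℝ)) *
    Real.log ((3 * (h : ℝ) + 1) * Real.exp 1 / δ)) ^ (1 / 3 : ℝ)

end Triest

end

namespace Triest

variable {V : Type*} [DecidableEq V]

/-! For `t ≤ M` the whole graph is stored and the estimate is exact. For `t > M` the sample is a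
uniformly random `M`-subset of the `t` edges and the counter is its number of triangles
(`run_of_ge`).

The dependence between edges is removed by comparison with independent sampling at rate `p = M / t`.
Conditioned on having size `M`, the independent sample is uniform, and `M` is the mode of its size,
so that size has probability at least `1 / (t + 1)`. Every event thus becomes at most `t + 1` times
likelier (`card_filter_powersetCard_le`).

Under independent sampling, triangle indicators depend on each other only through shared edges, each
lying in at most `h` triangles. Finner's inequality (`bernoulliExp_prod_rpow_le`), an iterated
Hölder inequality, bounds the exponential moment as for independent variables at the price of a
factor `1 / h` in the exponent. Chernoff's method then gives tails `exp (-η² μ / (4 h))`, where `μ =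
p³ |Δ|` (`bernoulliExp_tail_le`).

Since `ξ p³` is close to `1`, a relative error `ε` forces a deviation `η = ε / 2`. The cube of `Φ`
supplies the term `log (1 / δ)` in the exponent, and the factor `1 + ½ log^(2/3)` pays for the loss
`t + 1`. -/

theorem ValidUpTo.mono {e : ℕ → Sym2 V} {s t : ℕ} (h : ValidUpTo e t) (hst : s ≤ t) :
    ValidUpTo e s := fun r hr => h r (hr.trans_le hst)

theorem ValidUpTo.card_edges {e : ℕ → Sym2 V} {t : ℕ} (h : ValidUpTo e t) :
    (edges e t).card = t := by
  induction t with
  | zero => rfl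
  | succ t ih =>
    rw [edges, Finset.card_insert_of_notMem (h t t.lt_succ_self).2, ih (h.mono t.le_succ)]

theorem ValidUpTo.not_isDiag {e : ℕ → Sym2 V} {t : ℕ} (h : ValidUpTo e t) :
    ∀ a ∈ edges e t, ¬ a.IsDiag := by
  induction t with
  | zero => simp [edges]
  | succ t ih =>
    intro a ha
    rw [edges, Finset.mem_insert] at ha
    rcases ha with rfl | ha
    · exact (h t t.lt_succ_self).1
    · exact ih (h.mono t.le_succ) a ha

/-! ### Triangles and shared neighborhoods. -/

theorem mem_triangles {E T : Finset (Sym2 V)} :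
    T ∈ triangles E ↔ T ⊆ E ∧
      ∃ u v w : V, u ≠ v ∧ v ≠ w ∧ w ≠ u ∧ T = {s(u, v), s(v, w), s(w, u)} := by
  simp [triangles]

theorem card_of_mem_triangles {E T : Finset (Sym2 V)} (hT : T ∈ triangles E) : T.card = 3 := by
  obtain ⟨-, u, v, w, huv, hvw, hwu, rfl⟩ := mem_triangles.1 hT
  rw [Finset.card_eq_three]
  refine ⟨_, _, _, ?_, ?_, ?_, rfl⟩ <;> simp <;> grind

theorem triangles_eq_filter {E S : Finset (Sym2 V)} (h : S ⊆ E) :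
    triangles S = (triangles E).filter (· ⊆ S) := by
  ext T
  simp only [Finset.mem_filter, mem_triangles]
  exact ⟨fun hT => ⟨⟨hT.1.trans h, hT.2⟩, hT.1⟩, fun hT => ⟨hT.2, hT.1.2⟩⟩

/-- The counter is updated after the insertion. The new edge could only create a shared neighbor
that is one of its own ends, and this would require a loop. -/
theorem sharedNeighbors_insert {S : Finset (Sym2 V)} {a : Sym2 V} (ha : ¬ a.IsDiag)
    (hS : ∀ b ∈ S, ¬ b.IsDiag) : sharedNeighbors (insert a S) a = sharedNeighbors S a := by
  induction a using Sym2.ind with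
  | _ u v =>
    have hu : s(u, u) ∉ S := fun h => hS _ h (by simp)
    have hv : s(v, v) ∉ S := fun h => hS _ h (by simp)
    ext c
    simp only [sharedNeighbors, Set.mem_ofPred_eq, Sym2.mem_iff, forall_eq_or_imp, forall_eq,
      Finset.mem_insert, Sym2.eq_iff]
    simp only [Sym2.mk_isDiag_iff] at ha
    grind

/-- A triangle through `uv` is determined by its third vertex, so `c ↦ {uv, vc, cu}` is a bijection.
-/
theorem card_filter_mem_triangles_insert {S : Finset (Sym2 V)} {a : Sym2 V} (ha : ¬ a.IsDiag)
    (hS : ∀ b ∈ S, ¬ b.IsDiag) :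
    ((triangles (insert a S)).filter (a ∈ ·)).card = (sharedNeighbors S a).ncard := by
  induction a using Sym2.ind with
  | _ u v =>
    have hu : s(u, u) ∉ S := fun h => hS _ h (by simp)
    have hv : s(v, v) ∉ S := fun h => hS _ h (by simp)
    simp only [Sym2.mk_isDiag_iff] at ha
    have hmem : ∀ c, c ∈ sharedNeighbors S s(u, v) ↔ s(u, c) ∈ S ∧ s(v, c) ∈ S := by
      intro c
      simp [sharedNeighbors]
    set F : V → Finset (Sym2 V) := fun c => {s(u, v), s(v, c), s(c, u)} with hF
    have himage : (((triangles (insert s(u, v) S)).filter (s(u, v) ∈ ·) : Finset _) :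
        Set (Finset (Sym2 V))) = F '' sharedNeighbors S s(u, v) := by
      ext T
      simp only [Finset.coe_filter, Set.mem_ofPred_eq, mem_triangles, Set.mem_image, hmem]
      constructor
      · rintro ⟨⟨hsub, x, y, z, hxy, hyz, hzx, rfl⟩, hmemT⟩
        have h1 := hsub (Finset.mem_insert_self _ _)
        have h2 := hsub (Finset.mem_insert_of_mem (Finset.mem_insert_self _ _))
        have h3 := hsub (Finset.mem_insert_of_mem (Finset.mem_insert_of_mem
          (Finset.mem_singleton_self _)))
        simp only [Finset.mem_insert, Finset.mem_singleton, Sym2.eq_iff] at h1 h2 h3 hmemT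
        have hxz : s(z, x) = s(x, z) := Sym2.eq_swap
        have hyz' : s(z, y) = s(y, z) := Sym2.eq_swap
        have hxy' : s(y, x) = s(x, y) := Sym2.eq_swap
        -- Any of the three sides may be `uv`, in either orientation; the witness is the opposite
        -- vertex.
        rcases hmemT with (⟨rfl, rfl⟩ | ⟨rfl, rfl⟩) | (⟨rfl, rfl⟩ | ⟨rfl, rfl⟩) |
          (⟨rfl, rfl⟩ | ⟨rfl, rfl⟩)
        · exact ⟨z, by grind, by grind⟩
        · exact ⟨z, by grind, by
            ext b
            simp only [hF, Finset.mem_insert, Finset.mem_singleton]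
            grind⟩
        · exact ⟨x, by grind, by
            ext b
            simp only [hF, Finset.mem_insert, Finset.mem_singleton]
            grind⟩
        · exact ⟨x, by grind, by
            ext b
            simp only [hF, Finset.mem_insert, Finset.mem_singleton]
            grind⟩
        · exact ⟨y, by grind, by
            ext b
            simp only [hF, Finset.mem_insert, Finset.mem_singleton]
            grind⟩
        · exact ⟨y, by grind, by
            ext b
            simp only [hF, Finset.mem_insert, Finset.mem_singleton]
            grind⟩
      · rintro ⟨c, ⟨huc, hvc⟩, rfl⟩
        refine ⟨⟨?_, u, v, c, ha, ?_, ?_, rfl⟩, by simp [hF]⟩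
        · have : s(c, u) = s(u, c) := Sym2.eq_swap
          intro b hb
          simp only [hF, Finset.mem_insert, Finset.mem_singleton] at hb ⊢
          grind
        · rintro rfl; exact hv hvc
        · rintro rfl; exact hu huc
    rw [← Set.ncard_coe_finset, himage]
    refine Set.InjOn.ncard_image fun c hc d hd hcd => ?_
    rw [hmem] at hc hd
    have h : s(c, u) ∈ F d := hcd ▸ by simp [hF]
    simp only [hF, Finset.mem_insert, Finset.mem_singleton, Sym2.eq_iff] at h
    grind

theorem card_triangles_insert {S : Finset (Sym2 V)} {a : Sym2 V} (ha : ¬ a.IsDiag)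
    (haS : a ∉ S) (hS : ∀ b ∈ S, ¬ b.IsDiag) :
    (triangles (insert a S)).card = (triangles S).card + (sharedNeighbors S a).ncard := by
  rw [← card_filter_mem_triangles_insert ha hS,
    ← Finset.card_filter_add_card_filter_not (s := triangles (insert a S)) (a ∈ ·), add_comm]
  congr 2
  ext T
  simp only [Finset.mem_filter, mem_triangles]
  constructor
  · rintro ⟨⟨h1, h2⟩, h3⟩
    exact ⟨(Finset.subset_insert_iff_of_notMem h3).1 h1, h2⟩
  · rintro ⟨h1, h2⟩
    exact ⟨⟨h1.trans (Finset.subset_insert _ _), h2⟩, fun h => haS (h1 h)⟩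

/-- Each triangle is charged to one of its edges. The bound gives `h > 0` and keeps `t Φ` from being
small compared with a power of `t`. -/
theorem card_triangles_le (E : Finset (Sym2 V)) :
    (triangles E).card ≤ E.card * maxTrianglesPerEdge E := by
  classical
  have hsub : triangles E ⊆ E.biUnion fun a => (triangles E).filter (a ∈ ·) := by
    intro T hT
    obtain ⟨a, ha⟩ : T.Nonempty := Finset.card_pos.1 (by rw [card_of_mem_triangles hT]; norm_num)
    exact Finset.mem_biUnion.2 ⟨a, (mem_triangles.1 hT).1 ha, Finset.mem_filter.2 ⟨hT, ha⟩⟩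
  refine (Finset.card_le_card hsub).trans (Finset.card_biUnion_le_card_mul _ _ _ fun a ha => ?_)
  exact Finset.le_sup (f := fun a => ((triangles E).filter fun T => a ∈ T).card) ha

/-! ### Reservoir sampling. -/

section Reservoir

variable {α : Type*} [DecidableEq α]

theorem flipBiasedCoin_true {M t : ℕ} (h : M < t) : flipBiasedCoin M t h true = (M : ℝ≥0∞) / t := by
  have ht : (t : ℝ≥0) ≠ 0 := by exact_mod_cast (Nat.zero_lt_of_lt h).ne'
  simp [flipBiasedCoin, PMF.ofFintype_apply, ENNReal.coe_div ht]

theorem flipBiasedCoin_false {M t : ℕ} (h : M < t) :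
    flipBiasedCoin M t h false = 1 - (M : ℝ≥0∞) / t := by
  have ht : (t : ℝ≥0) ≠ 0 := by exact_mod_cast (Nat.zero_lt_of_lt h).ne'
  simp [flipBiasedCoin, PMF.ofFintype_apply, ENNReal.coe_div ht]

/-- One step of reservoir sampling: the law of the sample at the end of time step `t > M`, when the
element `x` arrives while the sample is `S`. -/
noncomputable def reservoirStep (M t : ℕ) (h : M < t) (x : α) (S : Finset α) : PMF (Finset α) :=
  (flipBiasedCoin M t h).bind fun heads =>
    if heads then
      if hS : S.Nonempty then
        (PMF.uniformOfFinset S hS).bind fun a => PMF.pure (insert x (S.erase a))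
      else PMF.pure (insert x S)
    else PMF.pure S

theorem reservoirStep_apply {M t : ℕ} (h : M < t) (hM : 0 < M) (x : α) {S : Finset α}
    (hS : S.card = M) (T : Finset α) :
    reservoirStep M t h x S T =
      (M : ℝ≥0∞) / t * ((M : ℝ≥0∞)⁻¹ * (S.filter fun a => T = insert x (S.erase a)).card) +
        (1 - (M : ℝ≥0∞) / t) * if T = S then 1 else 0 := by
  have hne : S.Nonempty := Finset.card_pos.1 (hS ▸ hM)
  rw [reservoirStep, PMF.bind_apply, tsum_fintype, Fintype.sum_bool, flipBiasedCoin_true,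
    flipBiasedCoin_false]
  simp only [if_true, Bool.false_eq_true, if_false, dif_pos hne, PMF.pure_apply]
  congr 2
  swap
  · split_ifs <;> rfl
  rw [PMF.bind_apply, tsum_eq_sum (s := S)]
  · rw [Finset.card_filter]
    push_cast
    rw [Finset.mul_sum]
    refine Finset.sum_congr rfl fun a ha => ?_
    rw [PMF.uniformOfFinset_apply_of_mem _ ha, hS, PMF.pure_apply]
    split_ifs <;> rfl
  · intro a ha
    rw [PMF.uniformOfFinset_apply_of_notMem _ ha, zero_mul]

/-- A pair `(S, a)` leading to `T` is determined by the evicted `a`, which ranges over `E \ (T \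
{x})`, since `S` is `T` with `x` replaced by `a`. -/
theorem card_sigma_insert_erase {E : Finset α} {x : α} (hx : x ∉ E) {M : ℕ} (hM : 0 < M)
    {T : Finset α} (hT : T ∈ (insert x E).powersetCard M) :
    ∑ S ∈ E.powersetCard M, (S.filter fun a => T = insert x (S.erase a)).card =
      if x ∈ T then E.card + 1 - M else 0 := by
  rw [Finset.mem_powersetCard] at hT
  rw [← Finset.card_sigma]
  split_ifs with hxT
  · have hsub : T.erase x ⊆ E := Finset.subset_insert_iff.1 hT.1
    have hcard : (E \ T.erase x).card = E.card + 1 - M := by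
      rw [Finset.card_sdiff_of_subset hsub, Finset.card_erase_of_mem hxT, hT.2]
      omega
    rw [← hcard]
    refine Finset.card_bij' (fun y _ => y.2) (fun a _ => ⟨insert a (T.erase x), a⟩) ?_ ?_ ?_ ?_
    · rintro ⟨S, a⟩ h
      simp only [Finset.mem_sigma, Finset.mem_powersetCard, Finset.mem_filter,
        Finset.mem_sdiff] at h ⊢
      obtain ⟨⟨hSE, -⟩, ha, rfl⟩ := h
      refine ⟨hSE ha, ?_⟩
      rw [Finset.erase_insert fun h => hx (hSE (Finset.mem_of_mem_erase h))]
      exact Finset.notMem_erase _ _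
    · intro a ha
      rw [Finset.mem_sdiff] at ha
      simp only [Finset.mem_sigma, Finset.mem_powersetCard, Finset.mem_filter]
      refine ⟨⟨Finset.insert_subset ha.1 hsub, ?_⟩, Finset.mem_insert_self _ _, ?_⟩
      · rw [Finset.card_insert_of_notMem ha.2, Finset.card_erase_add_one hxT, hT.2]
      · rw [Finset.erase_insert ha.2, Finset.insert_erase hxT]
    · rintro ⟨S, a⟩ h
      simp only [Finset.mem_sigma, Finset.mem_powersetCard, Finset.mem_filter] at h
      obtain ⟨⟨hSE, -⟩, ha, rfl⟩ := h
      dsimp only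
      rw [Finset.erase_insert fun h => hx (hSE (Finset.mem_of_mem_erase h)),
        Finset.insert_erase ha]
    · intro a _
      rfl
  · rw [Finset.card_eq_zero, Finset.eq_empty_iff_forall_notMem]
    rintro ⟨S, a⟩ h
    simp only [Finset.mem_sigma, Finset.mem_filter] at h
    exact hxT (h.2.2 ▸ Finset.mem_insert_self _ _)

/-- A reservoir step turns a uniformly random `M`-subset of `E` into one of `insert x E`. -/
theorem uniform_bind_reservoirStep {E : Finset α} {x : α} (hx : x ∉ E) {M n : ℕ} (hM : 0 < M)
    (hn : E.card = n) (hME : M < n + 1) (hne : (E.powersetCard M).Nonempty)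
    (hne' : ((insert x E).powersetCard M).Nonempty) :
    (PMF.uniformOfFinset (E.powersetCard M) hne).bind (reservoirStep M (n + 1) hME x) =
      PMF.uniformOfFinset ((insert x E).powersetCard M) hne' := by
  subst hn
  have hsum : ∀ T, (PMF.uniformOfFinset (E.powersetCard M) hne).bind
      (reservoirStep M (E.card + 1) hME x) T = ∑ S ∈ E.powersetCard M,
        ((E.card.choose M : ℝ≥0∞)⁻¹) * reservoirStep M (E.card + 1) hME x S T := by
    intro T
    rw [PMF.bind_apply, tsum_eq_sum (s := E.powersetCard M)]
    · refine Finset.sum_congr rfl fun S hS => ?_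
      rw [PMF.uniformOfFinset_apply_of_mem _ hS, Finset.card_powersetCard]
    · intro S hS
      rw [PMF.uniformOfFinset_apply_of_notMem _ hS, zero_mul]
  ext T
  rw [hsum]
  by_cases hT : T ∈ (insert x E).powersetCard M
  · rw [PMF.uniformOfFinset_apply_of_mem _ hT, Finset.card_powersetCard,
      Finset.card_insert_of_notMem hx, ← Finset.mul_sum]
    have : ∑ S ∈ E.powersetCard M, reservoirStep M (E.card + 1) hME x S T =
        (M : ℝ≥0∞) / (E.card + 1 : ℕ) * ((M : ℝ≥0∞)⁻¹ *
          ((if x ∈ T then E.card + 1 - M else 0 : ℕ) : ℝ≥0∞)) +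
        (1 - (M : ℝ≥0∞) / (E.card + 1 : ℕ)) * (if x ∈ T then 0 else 1) := by
      rw [Finset.sum_congr rfl fun S hS =>
        reservoirStep_apply hME hM x (Finset.mem_powersetCard.1 hS).2 T,
        Finset.sum_add_distrib, ← Finset.mul_sum, ← Finset.mul_sum, ← Finset.mul_sum,
        ← Nat.cast_sum, card_sigma_insert_erase hx hM hT, Finset.sum_ite_eq]
      congr 2
      rw [Finset.mem_powersetCard] at hT
      simp only [Finset.mem_powersetCard]
      by_cases hxT : x ∈ T
      · simp only [if_pos hxT, if_neg fun h : T ⊆ E ∧ T.card = M => hx (h.1 hxT)]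
      · have h : T ⊆ E ∧ T.card = M :=
          ⟨(Finset.subset_insert_iff_of_notMem hxT).1 hT.1, hT.2⟩
        simp only [if_neg hxT, if_pos h]
    rw [this]
    set n := E.card
    have hMn : M ≤ n := Nat.lt_succ_iff.1 hME
    have hc : (0 : ℝ≥0∞) < n.choose M := by exact_mod_cast Nat.choose_pos hMn
    have hM0 : (M : ℝ≥0∞) ≠ 0 := by exact_mod_cast hM.ne'
    have hn0 : ((n + 1 : ℕ) : ℝ≥0∞) ≠ 0 := by exact_mod_cast n.succ_ne_zero
    have hident : ((n + 1).choose M : ℝ≥0∞) * ((n + 1 - M : ℕ) : ℝ≥0∞) =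
        n.choose M * (n + 1 : ℕ) := by exact_mod_cast (Nat.choose_mul_succ_eq n M).symm
    -- Both cases give the factor `(n + 1 - M) / (n + 1)`: as `M / (n + 1) · (n + 1 - M) / M` when
    -- `x ∈ T`, and as the tails probability when `x ∉ T`.
    have hfinal : (n.choose M : ℝ≥0∞)⁻¹ * (((n + 1 - M : ℕ) : ℝ≥0∞) / (n + 1 : ℕ)) =
        ((n + 1).choose M : ℝ≥0∞)⁻¹ := by
      refine ENNReal.eq_inv_of_mul_eq_one_left ?_
      rw [div_eq_mul_inv, mul_assoc, mul_right_comm, mul_comm ((n + 1 - M : ℕ) : ℝ≥0∞), hident,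
        mul_assoc, ENNReal.mul_inv_cancel hn0 (ENNReal.natCast_ne_top _), mul_one,
        ENNReal.inv_mul_cancel hc.ne' (ENNReal.natCast_ne_top _)]
    rw [← hfinal]
    congr 1
    split_ifs with hxT
    · rw [mul_zero, add_zero, div_eq_mul_inv, mul_mul_mul_comm,
        ENNReal.mul_inv_cancel hM0 (ENNReal.natCast_ne_top _), one_mul, mul_comm, div_eq_mul_inv]
    · rw [Nat.cast_zero, mul_zero, mul_zero, zero_add, mul_one]
      refine ENNReal.sub_eq_of_eq_add
        (ENNReal.div_ne_top (ENNReal.natCast_ne_top _) hn0) ?_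
      rw [← ENNReal.add_div, ← Nat.cast_add, Nat.sub_add_cancel hME.le,
        ENNReal.div_self hn0 (ENNReal.natCast_ne_top _)]
  · rw [PMF.uniformOfFinset_apply_of_notMem _ hT]
    refine Finset.sum_eq_zero fun S hS => ?_
    have hS' := Finset.mem_powersetCard.1 hS
    rw [reservoirStep_apply hME hM x hS'.2, if_neg, Finset.filter_eq_empty_iff.2]
    · simp
    · rintro a ha rfl
      refine hT (Finset.mem_powersetCard.2 ⟨Finset.insert_subset_insert _
        ((Finset.erase_subset _ _).trans hS'.1), ?_⟩)
      rw [Finset.card_insert_of_notMem fun h => hx (hS'.1 (Finset.mem_of_mem_erase h)),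
        Finset.card_erase_add_one ha, hS'.2]
    · rintro rfl
      exact hT (Finset.powersetCard_mono (Finset.subset_insert _ _) hS)

theorem bind_congr_of_support {β γ : Type*} (p : PMF β) {f g : β → PMF γ}
    (h : ∀ b ∈ p.support, f b = g b) : p.bind f = p.bind g := by
  ext c
  rw [PMF.bind_apply, PMF.bind_apply]
  refine tsum_congr fun b => ?_
  by_cases hb : b ∈ p.support
  · rw [h b hb]
  · rw [(PMF.apply_eq_zero_iff _ _).2 hb, zero_mul, zero_mul]

end Reservoir

/-! ### The law of the algorithm's state. -/

/-- The state with sample `S` whose counter is the number of triangles of `S`. -/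
noncomputable def stateOf (S : Finset (Sym2 V)) : State V := ⟨S, (triangles S).card⟩

theorem insertEdge_stateOf {S : Finset (Sym2 V)} {a : Sym2 V} (ha : ¬ a.IsDiag) (haS : a ∉ S)
    (hS : ∀ b ∈ S, ¬ b.IsDiag) : insertEdge a (stateOf S) = stateOf (insert a S) := by
  simp only [insertEdge, updateCounters, stateOf, sharedNeighbors_insert ha hS,
    card_triangles_insert ha haS hS]
  push_cast
  rw [one_mul]

theorem removeEdge_stateOf {S : Finset (Sym2 V)} {a : Sym2 V} (haS : a ∈ S)
    (hS : ∀ b ∈ S, ¬ b.IsDiag) : removeEdge a (stateOf S) = stateOf (S.erase a) := by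
  have h := card_triangles_insert (hS a haS) (Finset.notMem_erase a S)
    fun b hb => hS b (Finset.mem_of_mem_erase hb)
  rw [Finset.insert_erase haS] at h
  simp only [removeEdge, updateCounters, stateOf, h]
  push_cast
  congr 1
  ring

theorem processEdge_stateOf_of_le {M t : ℕ} (h : t ≤ M) {S : Finset (Sym2 V)} {a : Sym2 V}
    (ha : ¬ a.IsDiag) (haS : a ∉ S) (hS : ∀ b ∈ S, ¬ b.IsDiag) :
    processEdge M t a (stateOf S) = PMF.pure (stateOf (insert a S)) := by
  rw [processEdge, sampleEdge, dif_pos h, PMF.pure_map]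
  simp [insertEdge_stateOf ha haS hS]

theorem processEdge_stateOf_of_lt {M t : ℕ} (h : M < t) {S : Finset (Sym2 V)} {a : Sym2 V}
    (ha : ¬ a.IsDiag) (haS : a ∉ S) (hS : ∀ b ∈ S, ¬ b.IsDiag) :
    processEdge M t a (stateOf S) = (reservoirStep M t h a S).map stateOf := by
  rw [processEdge, sampleEdge, dif_neg (not_le.2 h), reservoirStep, PMF.map_bind, PMF.map_bind]
  congr 1
  funext b
  cases b with
  | false => simp [PMF.pure_map]
  | true =>
    by_cases hne : S.Nonempty
    · have hne' : (stateOf S).sample.Nonempty := hne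
      rw [if_pos rfl, if_pos rfl, dif_pos hne, dif_pos hne', PMF.map_bind, PMF.map_bind]
      refine bind_congr_of_support _ fun b hb => ?_
      rw [PMF.mem_support_uniformOfFinset_iff] at hb
      have hb : b ∈ S := hb
      rw [PMF.pure_map, PMF.pure_map, if_pos rfl, removeEdge_stateOf hb hS,
        insertEdge_stateOf ha (fun h => haS (Finset.mem_of_mem_erase h))
          fun c hc => hS c (Finset.mem_of_mem_erase hc)]
    · have hne' : ¬ (stateOf S).sample.Nonempty := hne
      rw [if_pos rfl, if_pos rfl, dif_neg hne, dif_neg hne', PMF.pure_map, PMF.pure_map, if_pos rfl,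
        insertEdge_stateOf ha haS hS]

theorem triangles_empty : triangles (∅ : Finset (Sym2 V)) = ∅ := by
  refine Finset.eq_empty_of_forall_notMem fun T hT => ?_
  have h := card_of_mem_triangles hT
  rw [Finset.subset_empty.1 (mem_triangles.1 hT).1] at h
  simp at h

theorem run_of_le {M : ℕ} {e : ℕ → Sym2 V} {t : ℕ} (he : ValidUpTo e t) (h : t ≤ M) :
    run M e t = PMF.pure (stateOf (edges e t)) := by
  induction t with
  | zero => simp [run, stateOf, edges, triangles_empty]
  | succ t ih =>
    rw [run, ih (he.mono t.le_succ) (by omega), PMF.pure_bind, processEdge_stateOf_of_le h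
      (he t t.lt_succ_self).1 (he t t.lt_succ_self).2 (he.mono t.le_succ).not_isDiag, edges]

/-- From time `M` on, the sample is a uniformly random set of `M` edges of the graph, and the
counter is its number of triangles. -/
theorem run_of_ge {M : ℕ} (hM : 0 < M) {e : ℕ → Sym2 V} {t : ℕ} (he : ValidUpTo e t) (h : M ≤ t)
    (hne : ((edges e t).powersetCard M).Nonempty) :
    run M e t = (PMF.uniformOfFinset ((edges e t).powersetCard M) hne).map stateOf := by
  induction t, h using Nat.le_induction with
  | base =>
    have : PMF.uniformOfFinset ((edges e M).powersetCard M) hne = PMF.pure (edges e M) := by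
      ext T
      rw [PMF.uniformOfFinset_apply, PMF.pure_apply, Finset.card_powersetCard, he.card_edges,
        Nat.choose_self]
      have := Finset.powersetCard_self (edges e M)
      rw [he.card_edges] at this
      simp [this]
    rw [run_of_le he le_rfl, this, PMF.pure_map]
  | succ t h ih =>
    have het := he.mono t.le_succ
    have hcard := het.card_edges
    have hne' : ((edges e t).powersetCard M).Nonempty :=
      Finset.powersetCard_nonempty.2 (by rw [hcard]; exact h)
    simp only [edges] at hne ⊢
    rw [run, ih het hne', PMF.bind_map, ← uniform_bind_reservoirStep
      (he t t.lt_succ_self).2 hM hcard (by omega) hne' hne, PMF.map_bind]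
    refine bind_congr_of_support _ fun S hS => ?_
    rw [PMF.mem_support_uniformOfFinset_iff, Finset.mem_powersetCard] at hS
    rw [Function.comp_apply, processEdge_stateOf_of_lt (by omega : M < t + 1)
      (he t t.lt_succ_self).1 (fun h => (he t t.lt_succ_self).2 (hS.1 h))
      fun b hb => het.not_isDiag b (hS.1 hb)]

/-! ### Independent sampling: Finner's inequality and Chernoff bounds. -/

section Bernoulli

variable {α ι : Type*} [DecidableEq α] {p : ℝ}

/-- The expectation of `f` at a random subset of `E` that contains each element of `E`
independently with probability `p`. -/
noncomputable def bernoulliExp (p : ℝ) (E : Finset α)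
    (f : Finset α → ℝ) : ℝ :=
  ∑ S ∈ E.powerset, p ^ S.card * (1 - p) ^ (E.card - S.card) * f S

/-- Conditioning on whether `x` is sampled; this drives the inductions on `E`. -/
theorem bernoulliExp_insert {E : Finset α} {x : α} (hx : x ∉ E) (f : Finset α → ℝ) :
    bernoulliExp p (insert x E) f =
      p * bernoulliExp p E (fun S => f (insert x S)) + (1 - p) * bernoulliExp p E f := by
  unfold bernoulliExp
  rw [Finset.sum_powerset_insert hx, add_comm, Finset.mul_sum, Finset.mul_sum]
  congr 1
  · refine Finset.sum_congr rfl fun S hS => ?_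
    rw [Finset.mem_powerset] at hS
    rw [Finset.card_insert_of_notMem (fun h => hx (hS h)), Finset.card_insert_of_notMem hx,
      Nat.add_sub_add_right]
    ring
  · refine Finset.sum_congr rfl fun S hS => ?_
    rw [Finset.mem_powerset] at hS
    rw [Finset.card_insert_of_notMem hx, Nat.succ_sub (Finset.card_le_card hS), pow_succ]
    ring

theorem bernoulliExp_mono (hp : p ∈ Set.Icc (0 : ℝ) 1) {E : Finset α} {f g : Finset α → ℝ}
    (h : ∀ S ⊆ E, f S ≤ g S) : bernoulliExp p E f ≤ bernoulliExp p E g := by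
  refine Finset.sum_le_sum fun S hS => mul_le_mul_of_nonneg_left (h S (Finset.mem_powerset.1 hS)) ?_
  have := hp.1
  have : 0 ≤ 1 - p := sub_nonneg.2 hp.2
  positivity

theorem bernoulliExp_const_mul (E : Finset α) (c : ℝ) (f : Finset α → ℝ) :
    bernoulliExp p E (fun S => c * f S) = c * bernoulliExp p E f := by
  unfold bernoulliExp
  rw [Finset.mul_sum]
  exact Finset.sum_congr rfl fun S _ => by ring

theorem bernoulliExp_add (E : Finset α) (f g : Finset α → ℝ) :
    bernoulliExp p E (fun S => f S + g S) = bernoulliExp p E f + bernoulliExp p E g := by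
  unfold bernoulliExp
  rw [← Finset.sum_add_distrib]
  exact Finset.sum_congr rfl fun S _ => by ring

theorem bernoulliExp_one (E : Finset α) : bernoulliExp p E (fun _ => 1) = 1 := by
  induction E using Finset.induction_on with
  | empty => simp [bernoulliExp]
  | insert x E hx ih => rw [bernoulliExp_insert hx, ih]; ring

/-- Individual weights vanish when `p` is `0` or `1`, so positivity comes from the minimum of `f`
and the total mass `1`. -/
theorem bernoulliExp_pos (hp : p ∈ Set.Icc (0 : ℝ) 1) {E : Finset α} {f : Finset α → ℝ}
    (h : ∀ S, 0 < f S) : 0 < bernoulliExp p E f := by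
  obtain ⟨S₀, -, hS₀⟩ := E.powerset.exists_min_image f ⟨∅, by simp⟩
  calc 0 < f S₀ * bernoulliExp p E (fun _ => 1) := by rw [bernoulliExp_one, mul_one]; exact h S₀
    _ = bernoulliExp p E (fun _ => f S₀ * 1) := (bernoulliExp_const_mul _ _ _).symm
    _ ≤ _ := bernoulliExp_mono hp fun S hS => by
      rw [mul_one]; exact hS₀ S (Finset.mem_powerset.2 hS)

theorem bernoulliExp_subset {E T : Finset α} (hT : T ⊆ E) :
    bernoulliExp p E (fun S => if T ⊆ S then 1 else 0) = p ^ T.card := by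
  induction E using Finset.induction_on generalizing T with
  | empty => simp [bernoulliExp, Finset.subset_empty.1 hT]
  | insert x E hx ih =>
    rw [bernoulliExp_insert hx]
    by_cases hxT : x ∈ T
    · have h0 : bernoulliExp p E (fun S => if T ⊆ S then (1 : ℝ) else 0) = 0 :=
        Finset.sum_eq_zero fun S hS => by
          beta_reduce
          rw [if_neg fun h => hx (Finset.mem_powerset.1 hS (h hxT)), mul_zero]
      simp only [Finset.subset_insert_iff]
      rw [ih (Finset.subset_insert_iff.1 hT), h0, mul_zero, add_zero,
        ← Finset.card_erase_add_one hxT, pow_succ, mul_comm]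
    · simp only [Finset.subset_insert_iff_of_notMem hxT]
      rw [ih ((Finset.subset_insert_iff_of_notMem hxT).1 hT)]
      ring

/-- Hölder's inequality on a two-point probability space. -/
theorem two_point_holder (hp : p ∈ Set.Icc (0 : ℝ) 1) (I : Finset ι) {w : ℝ} (hw : 0 ≤ w)
    (hI : I.card * w ≤ 1) {A B : ι → ℝ} (hA : ∀ i ∈ I, 0 < A i) (hB : ∀ i ∈ I, 0 < B i) :
    p * ∏ i ∈ I, A i ^ w + (1 - p) * ∏ i ∈ I, B i ^ w ≤
      ∏ i ∈ I, (p * A i + (1 - p) * B i) ^ w := by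
  have hp0 := hp.1
  have hp1 : 0 ≤ 1 - p := sub_nonneg.2 hp.2
  have hC : ∀ i ∈ I, 0 < p * A i + (1 - p) * B i := by
    intro i hi
    have := hA i hi
    have := hB i hi
    rcases hp0.eq_or_lt with h | h
    · simpa [← h]
    · positivity
  have key : ∀ D : ι → ℝ, (∀ i ∈ I, 0 < D i) →
      ∏ i ∈ I, D i ^ w ≤ (∏ i ∈ I, (p * A i + (1 - p) * B i) ^ w) *
        (1 - I.card * w + ∑ i ∈ I, w * (D i / (p * A i + (1 - p) * B i))) := by
    intro D hD
    -- Weighted AM-GM for the normalized values; the extra index `none` carries the slack weight `1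
    -- - |I| w` with value `1`.
    have h := Real.geom_mean_le_arith_mean_weighted (Finset.insertNone I)
      (fun o => o.elim (1 - I.card * w) fun _ => w)
      (fun o => o.elim 1 fun i => D i / (p * A i + (1 - p) * B i))
      (by
        intro o _
        cases o with
        | none => simpa using hI
        | some i => exact hw)
      (by simp)
      (by
        intro o ho
        cases o with
        | none => simp
        | some i =>
          have hi : i ∈ I := by simpa using ho
          exact (div_pos (hD i hi) (hC i hi)).le)
    simp only [Finset.prod_insertNone, Finset.sum_insertNone, Option.elim_none, Option.elim_some,
      Real.one_rpow, one_mul, mul_one] at h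
    have h2 : ∏ i ∈ I, D i ^ w = (∏ i ∈ I, (p * A i + (1 - p) * B i) ^ w) *
        ∏ i ∈ I, (D i / (p * A i + (1 - p) * B i)) ^ w := by
      rw [← Finset.prod_mul_distrib]
      refine Finset.prod_congr rfl fun i hi => ?_
      rw [← Real.mul_rpow (hC i hi).le (div_pos (hD i hi) (hC i hi)).le,
        mul_div_cancel₀ _ (hC i hi).ne']
    rw [h2]
    exact mul_le_mul_of_nonneg_left h
      (Finset.prod_nonneg fun i hi => Real.rpow_nonneg (hC i hi).le _)
  have hsum : p * ∑ i ∈ I, w * (A i / (p * A i + (1 - p) * B i)) +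
      (1 - p) * ∑ i ∈ I, w * (B i / (p * A i + (1 - p) * B i)) = I.card * w := by
    rw [Finset.mul_sum, Finset.mul_sum, ← Finset.sum_add_distrib, ← nsmul_eq_mul,
      ← Finset.sum_const]
    refine Finset.sum_congr rfl fun i hi => ?_
    have := (hC i hi).ne'
    field_simp
  set Q := ∏ i ∈ I, (p * A i + (1 - p) * B i) ^ w
  calc _ ≤ p * (Q * (1 - I.card * w + ∑ i ∈ I, w * (A i / (p * A i + (1 - p) * B i)))) +
        (1 - p) * (Q * (1 - I.card * w + ∑ i ∈ I, w * (B i / (p * A i + (1 - p) * B i)))) :=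
        add_le_add (mul_le_mul_of_nonneg_left (key A hA) hp0)
          (mul_le_mul_of_nonneg_left (key B hB) hp1)
    _ = Q * (1 - I.card * w + (p * ∑ i ∈ I, w * (A i / (p * A i + (1 - p) * B i)) +
      (1 - p) * ∑ i ∈ I, w * (B i / (p * A i + (1 - p) * B i)))) := by ring
    _ = Q := by rw [hsum]; ring

/-- Finner's inequality for a random subset: if each element of `E` influences at most `1 / w` of
the functions `g i`, then the expectation of `∏ g i ^ w` is at most `∏ (𝔼 g i) ^ w`. -/
theorem bernoulliExp_prod_rpow_le (hp : p ∈ Set.Icc (0 : ℝ) 1) (I : Finset ι) {w : ℝ}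
    (hw : 0 ≤ w) (T : ι → Finset α) (E : Finset α)
    (hT : ∀ x ∈ E, (I.filter fun i => x ∈ T i).card * w ≤ 1) (g : ι → Finset α → ℝ)
    (hg : ∀ i S, 0 < g i S) (hgT : ∀ i x, x ∉ T i → ∀ S, g i (insert x S) = g i S) :
    bernoulliExp p E (fun S => ∏ i ∈ I, g i S ^ w) ≤ ∏ i ∈ I, bernoulliExp p E (g i) ^ w := by
  induction E using Finset.induction_on generalizing g with
  | empty => simp [bernoulliExp]
  | insert x E hx ih =>
    have hp0 := hp.1
    have hp1 : 0 ≤ 1 - p := sub_nonneg.2 hp.2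
    have hT' : ∀ y ∈ E, (I.filter fun i => y ∈ T i).card * w ≤ 1 :=
      fun y hy => hT y (Finset.mem_insert_of_mem hy)
    set A : ι → ℝ := fun i => bernoulliExp p E fun S => g i (insert x S) with hA
    set B : ι → ℝ := fun i => bernoulliExp p E (g i) with hB
    have hApos : ∀ i, 0 < A i := fun i => bernoulliExp_pos hp fun S => hg i _
    have hBpos : ∀ i, 0 < B i := fun i => bernoulliExp_pos hp fun S => hg i _
    have hAB : ∀ i, x ∉ T i → A i = B i := fun i hi => by simp only [hA, hB, hgT i x hi]
    have h1 := ih hT' (fun i S => g i (insert x S)) (fun i S => hg i _) fun i y hy S => by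
      rw [Finset.insert_comm, hgT i y hy]
    have h2 := ih hT' g hg hgT
    rw [bernoulliExp_insert hx]
    simp only [bernoulliExp_insert hx]
    -- Functions that do not depend on `x` have `A i = B i` and factor out, leaving few enough
    -- factors for the two-point inequality.
    calc _ ≤ p * ∏ i ∈ I, A i ^ w + (1 - p) * ∏ i ∈ I, B i ^ w :=
          add_le_add (mul_le_mul_of_nonneg_left h1 hp0) (mul_le_mul_of_nonneg_left h2 hp1)
      _ = (p * ∏ i ∈ I with x ∈ T i, A i ^ w + (1 - p) * ∏ i ∈ I with x ∈ T i, B i ^ w) *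
          ∏ i ∈ I with x ∉ T i, B i ^ w := by
          have : ∏ i ∈ I with x ∉ T i, A i ^ w = ∏ i ∈ I with x ∉ T i, B i ^ w :=
            Finset.prod_congr rfl fun i hi => by rw [hAB i (Finset.mem_filter.1 hi).2]
          rw [← Finset.prod_filter_mul_prod_filter_not I (fun i => x ∈ T i),
            ← Finset.prod_filter_mul_prod_filter_not I (fun i => x ∈ T i) (fun i => B i ^ w), this]
          ring
      _ ≤ (∏ i ∈ I with x ∈ T i, (p * A i + (1 - p) * B i) ^ w) *
          ∏ i ∈ I with x ∉ T i, B i ^ w := by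
          refine mul_le_mul_of_nonneg_right ?_
            (Finset.prod_nonneg fun i _ => Real.rpow_nonneg (hBpos i).le _)
          exact two_point_holder hp _ hw (hT x (Finset.mem_insert_self _ _)) (fun i _ => hApos i)
            fun i _ => hBpos i
      _ = ∏ i ∈ I, (p * A i + (1 - p) * B i) ^ w := by
          rw [← Finset.prod_filter_mul_prod_filter_not I (fun i => x ∈ T i)]
          congr 1
          refine Finset.prod_congr rfl fun i hi => ?_
          rw [hAB i (Finset.mem_filter.1 hi).2]
          congr 1
          ring

/-- The exponential moment of the number of members of the family `I` that a random subset
contains, when each element belongs to at most `h` members. -/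
theorem bernoulliExp_exp_card_le (hp : p ∈ Set.Icc (0 : ℝ) 1) {E : Finset α}
    {I : Finset (Finset α)} {h k : ℕ} (hh : 0 < h) (hI : ∀ T ∈ I, T ⊆ E ∧ T.card = k)
    (hdeg : ∀ x ∈ E, (I.filter fun T => x ∈ T).card ≤ h) (v : ℝ) :
    bernoulliExp p E (fun S => Real.exp (v / h * (I.filter (· ⊆ S)).card)) ≤
      Real.exp (p ^ k * I.card / h * (Real.exp v - 1)) := by
  have hh' : (0 : ℝ) < h := by exact_mod_cast hh
  -- This is `exp (v · 1[T ⊆ S])`, written affinely in the indicator to make its expectation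
  -- immediate.
  set g : Finset α → Finset α → ℝ := fun T S => 1 + (Real.exp v - 1) * if T ⊆ S then 1 else 0
    with hg
  have hgif : ∀ T S, g T S = Real.exp (v * if T ⊆ S then 1 else 0) := by
    intro T S
    by_cases hTS : T ⊆ S <;> simp [hg, hTS]
  have hfin := bernoulliExp_prod_rpow_le hp I (w := (h : ℝ)⁻¹) (by positivity) id E
    (by
      intro x hx
      rw [← div_eq_mul_inv, div_le_one hh']
      exact_mod_cast hdeg x hx) g
    (fun T S => by rw [hgif]; exact Real.exp_pos _)
    (fun T x hx S => by
      simp only [hg, Finset.subset_insert_iff_of_notMem (show x ∉ T from hx)])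
  have hleft : (fun S => Real.exp (v / h * (I.filter (· ⊆ S)).card)) =
      fun S => ∏ T ∈ I, g T S ^ ((h : ℝ)⁻¹) := by
    funext S
    simp only [hgif, ← Real.exp_mul]
    rw [← Real.exp_sum, Finset.card_filter]
    congr 1
    push_cast
    rw [Finset.mul_sum]
    exact Finset.sum_congr rfl fun T _ => by ring
  rw [hleft]
  refine hfin.trans ?_
  have hE : ∀ T ∈ I, bernoulliExp p E (g T) = 1 + (Real.exp v - 1) * p ^ k := by
    intro T hT
    rw [hg, bernoulliExp_add, bernoulliExp_one, bernoulliExp_const_mul,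
      bernoulliExp_subset (hI T hT).1, (hI T hT).2]
  calc _ ≤ ∏ T ∈ I, Real.exp ((Real.exp v - 1) * p ^ k * (h : ℝ)⁻¹) := by
        refine Finset.prod_le_prod (fun T _ => Real.rpow_nonneg (bernoulliExp_pos hp fun S => by
          rw [hgif]; exact Real.exp_pos _).le _) fun T hT => ?_
        rw [Real.exp_mul]
        refine Real.rpow_le_rpow (bernoulliExp_pos hp fun S => by
          rw [hgif]; exact Real.exp_pos _).le ?_ (by positivity)
        rw [hE T hT, add_comm]
        exact Real.add_one_le_exp _
    _ = _ := by
        rw [Finset.prod_const, ← Real.exp_nat_mul]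
        congr 1
        ring

/-- A two-sided Chernoff bound, with `σ = 1` for the upper tail and `σ = -1` for the lower one. -/
theorem bernoulliExp_tail_le (hp : p ∈ Set.Icc (0 : ℝ) 1) {E : Finset α}
    {I : Finset (Finset α)} {h k : ℕ} (hh : 0 < h) (hI : ∀ T ∈ I, T ⊆ E ∧ T.card = k)
    (hdeg : ∀ x ∈ E, (I.filter fun T => x ∈ T).card ≤ h) {η σ : ℝ} (hη : η ∈ Set.Icc (0 : ℝ) 1)
    (hσ : σ ^ 2 = 1) :
    bernoulliExp p E (fun S => if η * (p ^ k * I.card) ≤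
        σ * ((I.filter (· ⊆ S)).card - p ^ k * I.card) then 1 else 0) ≤
      Real.exp (-(η ^ 2 * (p ^ k * I.card) / (4 * h))) := by
  have hh' : (0 : ℝ) < h := by exact_mod_cast hh
  have hp0 := hp.1
  have hη0 := hη.1
  have hη1 := hη.2
  set μ : ℝ := p ^ k * I.card with hμ
  have hμ0 : 0 ≤ μ := by positivity
  -- With `exp v - 1 ≤ v + v²` the exponent is `(v² - η |v|) μ / h`, minimal at `|v| = η / 2`.
  set v : ℝ := σ * (η / 2) with hv
  have hv2 : v ^ 2 = η ^ 2 / 4 := by rw [hv, mul_pow, hσ]; ring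
  have hv1 : |v| ≤ 1 := by
    rw [← sq_le_one_iff_abs_le_one, hv2]
    nlinarith
  have hexp : Real.exp v - 1 ≤ v + v ^ 2 := by
    have := (abs_le.1 (Real.abs_exp_sub_one_sub_id_le hv1)).2
    linarith
  -- Markov's inequality in pointwise form.
  have hpoint : ∀ S, (if η * μ ≤ σ * ((I.filter (· ⊆ S)).card - μ) then (1 : ℝ) else 0) ≤
      Real.exp (-(v * μ / h + η ^ 2 / 2 * μ / h)) *
        Real.exp (v / h * (I.filter (· ⊆ S)).card) := by
    intro S
    split_ifs with hS
    · rw [← Real.exp_add]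
      refine Real.one_le_exp ?_
      have : -(v * μ / h + η ^ 2 / 2 * μ / h) + v / h * (I.filter (· ⊆ S)).card =
          η / 2 * (σ * ((I.filter (· ⊆ S)).card - μ) - η * μ) / h := by rw [hv]; ring
      rw [this]
      have := sub_nonneg.2 hS
      positivity
    · positivity
  refine (bernoulliExp_mono hp fun S _ => hpoint S).trans ?_
  rw [bernoulliExp_const_mul]
  refine (mul_le_mul_of_nonneg_left (bernoulliExp_exp_card_le hp hh hI hdeg v)
    (Real.exp_pos _).le).trans ?_
  rw [← Real.exp_add, Real.exp_le_exp, ← hμ]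
  have h1 : μ / h * (Real.exp v - 1) ≤ μ / h * (v + v ^ 2) :=
    mul_le_mul_of_nonneg_left hexp (by positivity)
  rw [hv2] at h1
  have h2 : μ / h * (v + η ^ 2 / 4) - (v * μ / h + η ^ 2 / 2 * μ / h) =
    -(η ^ 2 * μ / (4 * h)) := by field_simp; ring
  linarith

/-! ### From independent sampling to samples of fixed size. -/

/-- The binomial distribution with parameters `n` and `M / n` has its mode at `M`. -/
theorem binomial_le_mode {n M : ℕ} (hM : M ≤ n) (hn : 0 < n) {k : ℕ} (hk : k ≤ n) :
    (n.choose k : ℝ) * ((M : ℝ) / n) ^ k * (1 - (M : ℝ) / n) ^ (n - k) ≤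
      n.choose M * ((M : ℝ) / n) ^ M * (1 - (M : ℝ) / n) ^ (n - M) := by
  have hn' : (0 : ℝ) < n := by exact_mod_cast hn
  have hMn : (M : ℝ) ≤ n := by exact_mod_cast hM
  set q : ℝ := (M : ℝ) / n with hq
  have hq0 : 0 ≤ q := by positivity
  have hq1 : 0 ≤ 1 - q := sub_nonneg.2 ((div_le_one hn').2 hMn)
  have hqn : q * n = M := div_mul_cancel₀ _ hn'.ne'
  set b : ℕ → ℝ := fun k => (n.choose k : ℝ) * q ^ k * (1 - q) ^ (n - k) with hb
  have hb0 : ∀ k, 0 ≤ b k := fun k => by positivity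
  -- Since `(n - k) q - (k + 1) (1 - q) = M - k - 1 + q`, the weights increase up to `M` and
  -- decrease afterwards.
  have hstep : ∀ k < n, b (k + 1) * ((k + 1) * (1 - q)) = b k * ((n - k) * q) := by
    intro k hk
    have h1 : ((n.choose (k + 1) : ℝ)) * (k + 1) = n.choose k * (n - k) := by
      have := Nat.choose_succ_right_eq n k
      rw [← Nat.cast_sub hk.le]
      exact_mod_cast this
    have h2 : n - k = n - (k + 1) + 1 := by omega
    simp only [hb]
    rw [h2, pow_succ, pow_succ]
    linear_combination q ^ k * q * (1 - q) ^ (n - (k + 1)) * (1 - q) * h1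
  rcases hM.eq_or_lt with rfl | hMlt
  · have hq1' : q = 1 := by rw [hq, div_self hn'.ne']
    rcases hk.eq_or_lt with rfl | hk
    · exact le_rfl
    · simp only [hq1', sub_self]
      rw [zero_pow (by omega : M - k ≠ 0)]
      simp
  have hq1' : 0 < 1 - q := by
    have : q < 1 := (div_lt_one hn').2 (by exact_mod_cast hMlt)
    linarith
  rcases Nat.eq_zero_or_pos M with rfl | hM0
  · have hq0' : q = 0 := by simp [hq]
    rcases Nat.eq_zero_or_pos k with rfl | hk0
    · exact le_rfl
    · simp only [hq0']
      rw [zero_pow (by omega : k ≠ 0)]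
      simp
  have hqpos : 0 < q := div_pos (by exact_mod_cast hM0) hn'
  rcases le_total k M with hkM | hkM
  · refine Nat.decreasingInduction' (P := fun k => b k ≤ b M) ?_ hkM le_rfl
    intro j hj _ ih
    refine le_trans ?_ ih
    have hjn : (j : ℝ) < n := by exact_mod_cast hj.trans_le hM
    have hc : 0 < (n - j) * q := mul_pos (by linarith) hqpos
    have hjM : (j : ℝ) + 1 ≤ M := by exact_mod_cast hj
    refine le_of_mul_le_mul_right ?_ hc
    rw [← hstep j (hj.trans_le hM)]
    refine mul_le_mul_of_nonneg_left ?_ (hb0 _)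
    nlinarith
  · have : ∀ j, M ≤ j → j ≤ n → b j ≤ b M := by
      intro j hj
      induction j, hj using Nat.le_induction with
      | base => exact fun _ => le_rfl
      | succ j hj ih =>
        intro hjn
        refine le_trans ?_ (ih (by omega))
        have hjM : (M : ℝ) ≤ j := by exact_mod_cast hj
        have hc : 0 < ((j : ℝ) + 1) * (1 - q) := by positivity
        refine le_of_mul_le_mul_right ?_ hc
        rw [hstep j (by omega)]
        refine mul_le_mul_of_nonneg_left ?_ (hb0 _)
        nlinarith
    exact this k hkM hk

/-- The `n + 1` binomial weights sum to `1`, and none exceeds the one at `M`. -/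
theorem one_le_mul_binomial_mode {n M : ℕ} (hM : M ≤ n) (hn : 0 < n) :
    1 ≤ (n + 1 : ℝ) * (n.choose M * ((M : ℝ) / n) ^ M * (1 - (M : ℝ) / n) ^ (n - M)) := by
  have h := add_pow ((M : ℝ) / n) (1 - (M : ℝ) / n) n
  rw [add_sub_cancel, one_pow] at h
  refine h.trans_le ((Finset.sum_le_card_nsmul _ _
    (n.choose M * ((M : ℝ) / n) ^ M * (1 - (M : ℝ) / n) ^ (n - M)) fun k hk => ?_).trans_eq ?_)
  · rw [mul_comm, ← mul_assoc]
    exact binomial_le_mode hM hn (Nat.lt_succ_iff.1 (Finset.mem_range.1 hk))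
  · simp

/-- An event of a uniformly random `M`-subset of an `n`-set is at most `n + 1` times as likely as
the same event of a random subset with sampling probability `M / n`. -/
theorem card_filter_powersetCard_le {E : Finset α} {M : ℕ} (hM : M ≤ E.card) (hE : 0 < E.card)
    (P : Finset α → Prop) [DecidablePred P] :
    (((E.powersetCard M).filter P).card : ℝ) / E.card.choose M ≤
      (E.card + 1) * bernoulliExp ((M : ℝ) / E.card) E (fun S => if P S then 1 else 0) := by
  set n := E.card with hn
  set q : ℝ := (M : ℝ) / n with hq
  have hn' : (0 : ℝ) < n := by exact_mod_cast hE
  have hMn : (M : ℝ) ≤ n := by exact_mod_cast hM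
  have hq0 : 0 ≤ q := by positivity
  have hq1 : 0 ≤ 1 - q := sub_nonneg.2 ((div_le_one hn').2 hMn)
  have hc : (0 : ℝ) < n.choose M := by exact_mod_cast Nat.choose_pos hM
  -- Only sets of size `M` are kept, and these all have the same weight.
  have h1 : (((E.powersetCard M).filter P).card : ℝ) * (q ^ M * (1 - q) ^ (n - M)) ≤
      bernoulliExp q E (fun S => if P S then 1 else 0) := by
    rw [← nsmul_eq_mul, ← Finset.sum_const, bernoulliExp]
    calc _ = ∑ S ∈ (E.powersetCard M).filter P,
          q ^ S.card * (1 - q) ^ (E.card - S.card) * (if P S then 1 else 0) := by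
          refine Finset.sum_congr rfl fun S hS => ?_
          rw [Finset.mem_filter, Finset.mem_powersetCard] at hS
          rw [if_pos hS.2, hS.1.2, mul_one]
      _ ≤ _ := by
          refine Finset.sum_le_sum_of_subset_of_nonneg (fun S hS => ?_) fun S _ _ => ?_
          · rw [Finset.mem_filter, Finset.mem_powersetCard] at hS
            exact Finset.mem_powerset.2 hS.1.1
          · split_ifs <;> positivity
  have h2 := one_le_mul_binomial_mode hM hE
  rw [← hq] at h2
  rw [div_le_iff₀ hc]
  set N : ℝ := (((E.powersetCard M).filter P).card : ℝ)
  calc N = N * 1 := (mul_one _).symm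
    _ ≤ N * ((n + 1 : ℝ) * (n.choose M * q ^ M * (1 - q) ^ (n - M))) :=
      mul_le_mul_of_nonneg_left h2 (Nat.cast_nonneg _)
    _ = ((n : ℝ) + 1) * (n.choose M) * (N * (q ^ M * (1 - q) ^ (n - M))) := by ring
    _ ≤ ((n : ℝ) + 1) * (n.choose M) * bernoulliExp q E (fun S => if P S then 1 else 0) :=
      mul_le_mul_of_nonneg_left h1 (by positivity)
    _ = _ := by ring

end Bernoulli

/-! ### Failure probability of the estimate. -/

theorem toOuterMeasure_run {M : ℕ} (hM : 0 < M) {e : ℕ → Sym2 V} {t : ℕ} (he : ValidUpTo e t)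
    (h : M ≤ t) (A : Set (State V)) [DecidablePred fun S => stateOf S ∈ A] :
    ((run M e t).toOuterMeasure A).toReal =
      (((edges e t).powersetCard M).filter fun S => stateOf S ∈ A).card / t.choose M := by
  have hne : ((edges e t).powersetCard M).Nonempty :=
    Finset.powersetCard_nonempty.2 (by rw [he.card_edges]; exact h)
  rw [run_of_ge hM he h hne, PMF.toOuterMeasure_map_apply,
    PMF.toOuterMeasure_uniformOfFinset_apply, Finset.card_powersetCard, he.card_edges,
    ENNReal.toReal_div, ENNReal.toReal_natCast, ENNReal.toReal_natCast]
  congr! 4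

theorem xi_three_mul {M t : ℕ} (hM : 3 ≤ M) (h : M < t) :
    xi M 3 t * ((M : ℝ) * (M - 1) * (M - 2)) = t * (t - 1) * (t - 2) := by
  obtain ⟨m, rfl⟩ := Nat.exists_eq_add_of_le' hM
  obtain ⟨n, rfl⟩ := Nat.exists_eq_add_of_le' (hM.trans h.le)
  have hc : ((n.choose m : ℕ) : ℝ) ≠ 0 := by
    exact_mod_cast (Nat.choose_pos (by omega : m ≤ n)).ne'
  have h1 : ((n + 1 : ℕ) : ℝ) * n.choose m = (n + 1).choose (m + 1) * (m + 1 : ℕ) := by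
    exact_mod_cast Nat.add_one_mul_choose_eq n m
  have h2 : ((n + 2 : ℕ) : ℝ) * (n + 1).choose (m + 1) = (n + 2).choose (m + 2) * (m + 2 : ℕ) := by
    exact_mod_cast Nat.add_one_mul_choose_eq (n + 1) (m + 1)
  have h3 : ((n + 3 : ℕ) : ℝ) * (n + 2).choose (m + 2) = (n + 3).choose (m + 3) * (m + 3 : ℕ) := by
    exact_mod_cast Nat.add_one_mul_choose_eq (n + 2) (m + 2)
  rw [xi, if_neg (not_le.2 h), Nat.add_sub_cancel, Nat.add_sub_cancel, div_mul_eq_mul_div,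
    div_eq_iff hc]
  push_cast at *
  linear_combination (-(m + 2 : ℝ) * (m + 1)) * h3 - ((n + 3 : ℝ) * (m + 1)) * h2 -
    ((n + 3 : ℝ) * (n + 2)) * h1

/-- Comparison of `M³ / t³` with `1 / ξ`. -/
theorem xi_three_bounds {M t : ℕ} {ε : ℝ} (hε : 0 < ε) (h25 : 25 ≤ M) (h : M < t)
    (hM : 12 * ε⁻¹ ≤ M) :
    0 < xi M 3 t ∧ 1 ≤ xi M 3 t * ((M : ℝ) / t) ^ 3 ∧
      xi M 3 t * ((M : ℝ) / t) ^ 3 * (1 - ε / 4) ≤ 1 := by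
  have hM25 : (25 : ℝ) ≤ M := by exact_mod_cast h25
  have hMt : (M : ℝ) ≤ t := by exact_mod_cast h.le
  have hxi := xi_three_mul (by omega : 3 ≤ M) h
  have hD : 0 < (M : ℝ) * (M - 1) * (M - 2) :=
    mul_pos (mul_pos (by linarith) (by linarith)) (by linarith)
  have hN : 0 < (t : ℝ) * (t - 1) * (t - 2) :=
    mul_pos (mul_pos (by linarith) (by linarith)) (by linarith)
  have hxi' : xi M 3 t = t * (t - 1) * (t - 2) / ((M : ℝ) * (M - 1) * (M - 2)) :=
    (eq_div_iff hD.ne').2 hxi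
  have ht : (0 : ℝ) < t := by linarith
  have hM0 : (0 : ℝ) < M := by linarith
  have hM1 : (0 : ℝ) < M - 1 := by linarith
  have hM2 : (0 : ℝ) < M - 2 := by linarith
  have hform : xi M 3 t * ((M : ℝ) / t) ^ 3 =
      (t - 1) * (t - 2) * M ^ 2 / (t ^ 2 * ((M - 1) * (M - 2))) := by
    rw [hxi']
    field_simp
  refine ⟨hxi' ▸ div_pos hN hD, ?_, ?_⟩
  · rw [hform, one_le_div (by positivity)]
    have h1 : (M - 1 : ℝ) * t ≤ (t - 1) * M := by linarith
    have h2 : (M - 2 : ℝ) * t ≤ (t - 2) * M := by linarith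
    have := mul_le_mul h1 h2 (by positivity) (mul_nonneg (by linarith) hM0.le)
    linarith
  -- Source of the constant `12`: the loss `3 M` in `(M - 1) (M - 2)` must be at most `(ε / 4) M²`.
  · have hεM : 3 ≤ ε / 4 * M := by
      have := mul_le_mul_of_nonneg_left hM (by positivity : 0 ≤ ε / 4)
      have h12 : ε / 4 * (12 * ε⁻¹) = 3 := by field_simp; norm_num
      linarith
    rw [hform, div_mul_eq_mul_div, div_le_one (by positivity)]
    have h1 : (t - 1 : ℝ) * (t - 2) ≤ t ^ 2 := by nlinarith
    have h2 : (M : ℝ) ^ 2 * (1 - ε / 4) ≤ (M - 1) * (M - 2) := by nlinarith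
    calc (t - 1 : ℝ) * (t - 2) * M ^ 2 * (1 - ε / 4)
        = ((t - 1 : ℝ) * (t - 2)) * (M ^ 2 * (1 - ε / 4)) := by ring
      _ ≤ ((t - 1 : ℝ) * (t - 2)) * ((M - 1) * (M - 2)) :=
        mul_le_mul_of_nonneg_left h2 (mul_nonneg (by linarith) (by linarith))
      _ ≤ _ := mul_le_mul_of_nonneg_right h1 (by positivity)

/-- A relative error of at least `ε` of the estimate forces a relative deviation of at least
`ε / 2` of the counter from its mean under independent sampling. -/
theorem deviation_of_error {N τ q ξ ε : ℝ} (hN : 0 ≤ N) (hε : ε ∈ Set.Ioo (0 : ℝ) 1) (hξ : 0 < ξ)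
    (h1 : 1 ≤ ξ * q) (h2 : ξ * q * (1 - ε / 4) ≤ 1) (h : ε * N ≤ |ξ * τ - N|) :
    ε / 2 * (q * N) ≤ 1 * (τ - q * N) ∨ ε / 2 * (q * N) ≤ -1 * (τ - q * N) := by
  obtain ⟨hε0, hε1⟩ := hε
  rcases le_abs.1 h with h | h
  · left
    refine le_of_mul_le_mul_left ?_ hξ
    have h3 : ξ * q * (1 + ε / 2) ≤ 1 + ε := by
      have : ξ * q * (1 + ε / 2) ≤ ξ * q * ((1 - ε / 4) * (1 + ε)) :=
        mul_le_mul_of_nonneg_left (by nlinarith) (by linarith)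
      nlinarith
    nlinarith [mul_le_mul_of_nonneg_right h3 hN]
  · right
    refine le_of_mul_le_mul_left ?_ hξ
    have h3 : 1 - ε ≤ ξ * q * (1 - ε / 2) := by nlinarith
    nlinarith [mul_le_mul_of_nonneg_right h3 hN]

/-- The failure probability of the estimate, before any choice of the sample size. -/
theorem failure_probability_le {M : ℕ} {e : ℕ → Sym2 V} {t : ℕ} (he : ValidUpTo e t)
    {ε : ℝ} (hε : ε ∈ Set.Ioo (0 : ℝ) 1) (h25 : 25 ≤ M) (h : M < t) (hM : 12 * ε⁻¹ ≤ M)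
    (hh : 0 < maxTrianglesPerEdge (edges e t)) :
    ((run M e t).toOuterMeasure {st | |estimate M t st - ((triangles (edges e t)).card : ℝ)| <
        ε * ((triangles (edges e t)).card : ℝ)}ᶜ).toReal ≤
      2 * ((t + 1) * Real.exp (-((ε / 2) ^ 2 * (((M : ℝ) / t) ^ 3 * (triangles (edges e t)).card) /
        (4 * maxTrianglesPerEdge (edges e t))))) := by
  classical
  set E := edges e t with hE
  set N : ℝ := ((triangles E).card : ℝ) with hN
  have hcard : E.card = t := he.card_edges
  have ht : (0 : ℝ) < t := by exact_mod_cast (by omega : 0 < t)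
  have hp : (M : ℝ) / t ∈ Set.Icc (0 : ℝ) 1 :=
    ⟨by positivity, (div_le_one ht).2 (by exact_mod_cast h.le)⟩
  obtain ⟨hξ, hξ1, hξ2⟩ := xi_three_bounds hε.1 h25 h hM
  rw [toOuterMeasure_run (by omega) he h.le, ← hE]
  have hle := card_filter_powersetCard_le (E := E) (M := M) (by omega) (by omega)
    fun S => stateOf S ∈ {st : State V | |estimate M t st - N| < ε * N}ᶜ
  rw [hcard] at hle
  refine hle.trans ?_
  rw [mul_left_comm]
  refine mul_le_mul_of_nonneg_left ?_ (by positivity)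
  have htail := fun σ (hσ : σ ^ 2 = 1) => bernoulliExp_tail_le hp (E := E) (I := triangles E)
    (k := 3) hh (fun T hT => ⟨(mem_triangles.1 hT).1, card_of_mem_triangles hT⟩)
    (fun a ha => Finset.le_sup (f := fun a => ((triangles E).filter fun T => a ∈ T).card) ha)
    (η := ε / 2) (σ := σ) ⟨by linarith [hε.1], by linarith [hε.2]⟩ hσ
  -- Union bound over the two tails.
  rw [two_mul]
  refine le_trans ?_ (add_le_add (htail 1 (by norm_num)) (htail (-1) (by norm_num)))
  rw [← bernoulliExp_add]
  refine bernoulliExp_mono hp fun S hS => ?_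
  by_cases hbad : stateOf S ∈ {st : State V | |estimate M t st - N| < ε * N}ᶜ
  · rw [if_pos hbad]
    rw [Set.mem_compl_iff, Set.mem_ofPred_eq, not_lt] at hbad
    simp only [estimate, stateOf, Int.cast_natCast] at hbad
    rw [triangles_eq_filter hS] at hbad
    rcases deviation_of_error (Nat.cast_nonneg _) hε hξ hξ1 hξ2 hbad with h | h
    · rw [if_pos h]
      exact le_add_of_nonneg_right (by split_ifs <;> norm_num)
    · rw [if_pos h]
      exact le_add_of_nonneg_left (by split_ifs <;> norm_num)
  · rw [if_neg hbad]
    exact add_nonneg (by split_ifs <;> norm_num) (by split_ifs <;> norm_num)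

/-! ### Numerical estimates for `Φ` and the conclusion. -/

theorem Phi_cube {ε δ : ℝ} {h D : ℕ} (hδ : δ ∈ Set.Ioo (0 : ℝ) 1) :
    Phi ε δ h D ^ 3 = 8 * ε⁻¹ ^ 2 * ((3 * (h : ℝ) + 1) / D) *
      Real.log ((3 * (h : ℝ) + 1) * Real.exp 1 / δ) := by
  have hlog : 0 ≤ Real.log ((3 * (h : ℝ) + 1) * Real.exp 1 / δ) := by
    refine Real.log_nonneg ((one_le_div hδ.1).2 (hδ.2.le.trans ?_))
    exact one_le_mul_of_one_le_of_one_le (by linarith [(Nat.cast_nonneg h : (0 : ℝ) ≤ h)])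
      (Real.one_le_exp zero_le_one)
  rw [Phi, ← Real.rpow_natCast, ← Real.rpow_mul (by positivity)]
  norm_num

/-- The choice of `Φ` makes the bound of `failure_probability_le` smaller than `δ`. -/
theorem failure_bound_lt {M t h N : ℕ} {ε δ : ℝ} (hε : ε ∈ Set.Ioo (0 : ℝ) 1)
    (hδ : δ ∈ Set.Ioo (0 : ℝ) 1) (ht : 0 < t) (hh : 0 < h) (hN : 0 < N) (hNt : N ≤ t * h)
    (hM : (t : ℝ) * Phi ε δ h N *
      (1 + 1 / 2 * Real.log ((t : ℝ) * Phi ε δ h N) ^ (2 / 3 : ℝ)) ≤ M) :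
    2 * ((t + 1) * Real.exp (-((ε / 2) ^ 2 * (((M : ℝ) / t) ^ 3 * N) / (4 * h)))) < δ := by
  obtain ⟨hε0, hε1⟩ := hε
  have hcube := Phi_cube (ε := ε) (h := h) (D := N) hδ
  set Φ := Phi ε δ h N with hΦ
  set L := Real.log ((3 * (h : ℝ) + 1) * Real.exp 1 / δ) with hL
  have hδ0 := hδ.1
  have ht1 : (1 : ℝ) ≤ t := by exact_mod_cast ht
  have hh1 : (1 : ℝ) ≤ h := by exact_mod_cast hh
  have hN1 : (1 : ℝ) ≤ N := by exact_mod_cast hN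
  have hNt' : (N : ℝ) ≤ t * h := by exact_mod_cast hNt
  -- Here `3 h + 1 ≥ 4`; the summand `1` will make the final inequality strict.
  have hLlow : Real.log (4 / δ) + 1 ≤ L := by
    rw [← Real.log_exp 1, ← Real.log_mul (by positivity) (Real.exp_pos _).ne', hL]
    refine Real.log_le_log (by positivity) ?_
    rw [div_mul_eq_mul_div]
    gcongr
    linarith
  have hlog4 : 0 ≤ Real.log (4 / δ) :=
    Real.log_nonneg ((one_le_div hδ0).2 (by linarith [hδ.2]))
  have hL1 : 1 ≤ L := by linarith
  have hεinv : 1 ≤ ε⁻¹ ^ 2 := one_le_pow₀ ((one_le_inv₀ hε0).2 hε1.le)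
  have hΦ0 : 0 ≤ Φ := by
    rw [hΦ, Phi]
    refine Real.rpow_nonneg ?_ _
    rw [← hL]
    positivity
  have hΦt : 1 ≤ Φ ^ 3 * t := by
    have h3 : 1 ≤ (3 * (h : ℝ) + 1) / N * t := by
      rw [div_mul_eq_mul_div, one_le_div (by linarith)]
      nlinarith
    rw [hcube]
    calc (1 : ℝ) ≤ 8 * ε⁻¹ ^ 2 * (((3 * (h : ℝ) + 1) / N * t) * L) :=
          one_le_mul_of_one_le_of_one_le (by linarith) (one_le_mul_of_one_le_of_one_le h3 hL1)
      _ = _ := by ring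
  -- This turns `log t` into at most `(3 / 2) log (t Φ)`, the quantity in the hypothesis on `M`.
  have hy3 : (t : ℝ) ^ 2 ≤ (t * Φ) ^ 3 := by
    calc (t : ℝ) ^ 2 = t ^ 2 * 1 := (mul_one _).symm
      _ ≤ t ^ 2 * (Φ ^ 3 * t) := mul_le_mul_of_nonneg_left hΦt (by positivity)
      _ = _ := by ring
  set l := Real.log ((t : ℝ) * Φ) with hl
  have hlt : 2 * Real.log t ≤ 3 * l := by
    have := Real.log_le_log (by positivity) hy3
    rwa [Real.log_pow, Real.log_pow] at this
  have hlogt : 0 ≤ Real.log t := Real.log_nonneg ht1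
  have hl0 : 0 ≤ l := by linarith
  set s := l ^ (1 / 3 : ℝ) with hs
  have hs0 : 0 ≤ s := Real.rpow_nonneg hl0 _
  have hs3 : s ^ 3 = l := by
    rw [hs, ← Real.rpow_natCast, ← Real.rpow_mul hl0]
    norm_num
  have hs2 : l ^ (2 / 3 : ℝ) = s ^ 2 := by
    rw [hs, ← Real.rpow_natCast, ← Real.rpow_mul hl0]
    norm_num
  rw [hs2] at hM
  have hp3 : Φ ^ 3 * (1 + 1 / 2 * s ^ 2) ^ 3 ≤ ((M : ℝ) / t) ^ 3 := by
    rw [← mul_pow]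
    refine pow_le_pow_left₀ (by positivity) ?_ 3
    rw [le_div_iff₀ (by linarith)]
    linarith
  have hexponent : L + Real.log t ≤ (ε / 2) ^ 2 * (((M : ℝ) / t) ^ 3 * N) / (4 * h) := by
    calc L + Real.log t ≤ 3 / 2 * L * (1 + 1 / 2 * s ^ 2) ^ 3 := by
          -- The cube contains `(3/2) s² + (3/4) s⁴`, which dominates `(3/2) s³` because `s² + s⁴ ≥
          -- 2 s³`.
          have h1 : 1 + 3 / 2 * s ^ 3 ≤ 3 / 2 * (1 + 1 / 2 * s ^ 2) ^ 3 := by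
            nlinarith [sq_nonneg (s * (s - 1)), sq_nonneg s, pow_nonneg hs0 6]
          have h2 := mul_le_mul_of_nonneg_left h1 (by linarith : 0 ≤ L)
          have h3 : Real.log t ≤ 3 / 2 * s ^ 3 := by rw [hs3]; linarith
          have h4 : 3 / 2 * s ^ 3 ≤ L * (3 / 2 * s ^ 3) :=
            le_mul_of_one_le_left (by positivity) hL1
          linarith
      _ ≤ (3 * h + 1) / (2 * h) * L * (1 + 1 / 2 * s ^ 2) ^ 3 := by
          gcongr ?_ * _ * _
          rw [div_le_div_iff₀ (by norm_num) (by positivity)]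
          linarith
      _ = (ε / 2) ^ 2 * (Φ ^ 3 * (1 + 1 / 2 * s ^ 2) ^ 3 * N) / (4 * h) := by
          rw [hcube]
          have : (N : ℝ) ≠ 0 := by positivity
          field_simp
          ring
      _ ≤ _ := by gcongr
  have hexp : Real.exp (-((ε / 2) ^ 2 * (((M : ℝ) / t) ^ 3 * N) / (4 * h))) ≤
      δ / 4 * Real.exp (-1) * (t : ℝ)⁻¹ := by
    have h1 : Real.exp (-(Real.log (4 / δ) + 1 + Real.log t)) =
        δ / 4 * Real.exp (-1) * (t : ℝ)⁻¹ := by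
      rw [neg_add, neg_add, Real.exp_add, Real.exp_add, Real.exp_neg (Real.log _),
        Real.exp_neg (Real.log _), Real.exp_log (by positivity), Real.exp_log (by positivity),
        inv_div]
    rw [← h1, Real.exp_le_exp]
    linarith
  have he1 : Real.exp (-1) < 1 := by
    rw [← Real.exp_zero]
    exact Real.exp_lt_exp.2 (by norm_num)
  have htt : ((t : ℝ) + 1) * (t : ℝ)⁻¹ ≤ 2 := by
    rw [← div_eq_mul_inv, div_le_iff₀ (by linarith)]
    linarith
  calc _ ≤ 2 * ((t + 1) * (δ / 4 * Real.exp (-1) * (t : ℝ)⁻¹)) := by gcongr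
    _ = δ / 2 * Real.exp (-1) * ((t + 1) * (t : ℝ)⁻¹) := by ring
    _ ≤ δ / 2 * Real.exp (-1) * 2 := by gcongr
    _ = δ * Real.exp (-1) := by ring
    _ < δ := mul_lt_of_lt_one_right hδ0 he1

end Triest

theorem mainTheorem3 {V : Type*} [DecidableEq V] (e : ℕ → Sym2 V) (t : ℕ)
    (he : Triest.ValidUpTo e t)
    (hΔ : 0 < (Triest.triangles (Triest.edges e t)).card)
    (ε δ : ℝ) (hε : ε ∈ Set.Ioo (0 : ℝ) 1) (hδ : δ ∈ Set.Ioo (0 : ℝ) 1)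
    (Φ : ℝ)
    (hΦ : Φ = Triest.Phi ε δ (Triest.maxTrianglesPerEdge (Triest.edges e t))
      (Triest.triangles (Triest.edges e t)).card)
    (M : ℕ)
    (hM : max (max ((t : ℝ) * Φ * (1 + 1 / 2 * Real.log ((t : ℝ) * Φ) ^ (2 / 3 : ℝ)))
      (12 * ε⁻¹ + Real.exp 1 ^ 2)) 25 ≤ (M : ℝ)) :
    1 - δ < ((Triest.run M e t).toOuterMeasure
      {st | |Triest.estimate M t st - ((Triest.triangles (Triest.edges e t)).card : ℝ)| <
        ε * ((Triest.triangles (Triest.edges e t)).card : ℝ)}).toReal := by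
  classical
  have hN : (0 : ℝ) < (Triest.triangles (Triest.edges e t)).card := by exact_mod_cast hΔ
  rcases le_or_gt t M with h | h
  · rw [Triest.run_of_le he h, PMF.toOuterMeasure_pure_apply, if_pos]
    · simpa using hδ.1
    · have : 0 < ε * ((Triest.triangles (Triest.edges e t)).card : ℝ) := mul_pos hε.1 hN
      simpa [Triest.estimate, Triest.stateOf, Triest.xi, h] using this
  · obtain ⟨⟨hMΦ, hMε⟩, hM25⟩ := by simpa only [max_le_iff] using hM
    have h25 : 25 ≤ M := by exact_mod_cast hM25
    have hMε' : 12 * ε⁻¹ ≤ M := by linarith [sq_nonneg (Real.exp 1)]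
    have hNt := Triest.card_triangles_le (Triest.edges e t)
    rw [he.card_edges] at hNt
    have hh : 0 < Triest.maxTrianglesPerEdge (Triest.edges e t) :=
      Nat.pos_of_mul_pos_left (hΔ.trans_le hNt)
    rw [hΦ] at hMΦ
    have hfail := (Triest.failure_probability_le he hε h25 h hMε' hh).trans_lt
      (Triest.failure_bound_lt hε hδ (by omega) hh hΔ hNt hMΦ)
    rw [Triest.toOuterMeasure_run (by omega) he h.le] at hfail ⊢
    -- Good and bad samples together number `t.choose M`, so the failure bound yields the success
    -- bound.
    have hsum := Finset.card_filter_add_card_filter_not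
      (s := (Triest.edges e t).powersetCard M)
      (fun S => Triest.stateOf S ∈ {st : Triest.State V | |Triest.estimate M t st -
        ((Triest.triangles (Triest.edges e t)).card : ℝ)| <
        ε * ((Triest.triangles (Triest.edges e t)).card : ℝ)})
    rw [Finset.card_powersetCard, he.card_edges] at hsum
    have hc : (0 : ℝ) < t.choose M := by exact_mod_cast Nat.choose_pos h.le
    simp only [Set.mem_compl_iff] at hfail
    rw [div_lt_iff₀ hc] at hfail
    rw [lt_div_iff₀ hc]
    have hsum' := congrArg (Nat.cast (R := ℝ)) hsum
    push_cast at hsum'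
    linarith
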